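/- Let $\omega:[0,\infty)\to[0,\infty)$ be a modulus of continuity, i.e. a nondecreasing continuous function with $\omega(0)=0$, $\omega(x)>0$ for $x>0$, and $\omega(x+y)\le\omega(x)+\omega(y)$ for all $x,y\ge 0$. Put $$\omega_\sharp(x)=x\int_x^\infty\frac{\omega(t)}{t^2}\,dt+\int_0^x\frac{\omega(t)}{t}\,dt,\qquad x>0,$$ and assume that $\omega_\sharp(x)<\infty$ for all $x>0$. Then there exist a complex Hilbert space, (bounded) self-adjoint operators $A$ and $B$ on it, and a function $f:\mathbb{R}\to\mathbb{R}$ in $\Lambda_{\omega_\sharp}(\mathbb{R})$, i.e. with $$\sup_{x\neq y}\frac{|f(x)-f(y)|}{\omega_\sharp(|x-y|)}<\infty,$$ such that $$\operatorname{rank}(A-B)=1\qquad\text{and}\qquad s_m\bigl(f(A)-f(B)\bigr)\ge\omega\bigl((1+m)^{-1}\bigr)\quad\text{for all integers } m\ge 0,$$ where $s_m(T)=\inf\{\|T-R\|:\ \operatorname{rank}R\le m\}$ are the singular values of a bounded operator $T$ and $f(A)$, $f(B)$ are given by the functional calculus. -/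

import Mathlib

open MeasureTheory Set

noncomputable section

/-- `w` is a modulus of continuity. Only its values on `[0, ∞)` matter. -/
structure IsModulusOfContinuity (w : ℝ → ℝ) : Prop where
  monotoneOn : MonotoneOn w (Ici 0)
  continuousOn : ContinuousOn w (Ici 0)
  map_zero : w 0 = 0
  pos : ∀ x, 0 < x → 0 < w x
  subadditive : ∀ x y, 0 ≤ x → 0 ≤ y → w (x + y) ≤ w x + w y

/-- `w♯(x) = x ∫_x^∞ w(t)/t² dt + ∫_0^x w(t)/t dt`, for `x > 0`. -/
def omegaSharp (w : ℝ → ℝ) (x : ℝ) : ℝ :=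
  x * (∫ t in Ioi x, w t / t ^ 2) + ∫ t in Ioc 0 x, w t / t

/-- `w♯` is finite valued on `(0, ∞)`: both integrals in its definition converge
(the integrands are nonnegative). -/
def OmegaSharpFinite (w : ℝ → ℝ) : Prop :=
  ∀ x, 0 < x →
    IntegrableOn (fun t => w t / t ^ 2) (Ioi x) ∧ IntegrableOn (fun t => w t / t) (Ioc 0 x)

/-- The real functions in the space `Λ_σ(ℝ)`: those with
`sup_{x ≠ y} |f x - f y| / σ |x - y| < ∞`. -/
def MemLambda (σ : ℝ → ℝ) (f : ℝ → ℝ) : Prop :=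
  ∃ C : ℝ, ∀ x y : ℝ, x ≠ y → |f x - f y| ≤ C * σ |x - y|

/-- The singular values `s_j(T) = inf {‖T - R‖ : rank R ≤ j}` of a bounded operator. -/
def singularValue {H : Type*} [NormedAddCommGroup H] [InnerProductSpace ℂ H]
    (T : H →L[ℂ] H) (j : ℕ) : ℝ :=
  sInf {r : ℝ | ∃ R : H →L[ℂ] H, LinearMap.rank (R : H →ₗ[ℂ] H) ≤ (j : Cardinal) ∧ r = ‖T - R‖}

end

/-!
For `N = 4 · 2ⁿ` and a Chebyshev polynomial `T_N`, put `p_N = (1 - X²) T_N`. The function is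
the lacunary series `f = ∑ₙ 8 ω(2⁻ⁿ) p_{4·2ⁿ}` on `[-1, 1]`, extended by constants.

*Smoothness.* On `[-1, 1]` one has `|p_N| ≤ 1` and `|p_N'| ≤ N + 2`; the factor `1 - X²` is what
makes the derivative grow like `N` and not like `N²`. Hence `|f(x) - f(y)|` is at most a constant
times `∑ₙ ω(2⁻ⁿ) min(1, 2ⁿ |x - y|)`. Comparing the `n`-th term with the integral over
`(2⁻ⁿ, 2¹⁻ⁿ]` bounds this sum by `4 ω♯(|x - y|)` (`IsModulusOfContinuity.sum_dyadic_le`), so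
`f ∈ Λ_{ω♯}` (`IsModulusOfContinuity.memLambda_lacunaryFun`).

*Operators.* On `ℓ²(ℕ)` let `A` and `B` be `(S + S*) / 2 ± (e₀ ⊗ e₀) / 2` with the unilateral shift
`S`; then `A - B = e₀ ⊗ e₀` has rank one, and both operators are contractions. They are the even and
the odd part of `(U + U*) / 2`, for the bilateral shift `U`, with respect to the reflection
`j ↦ -1 - j`. Setting `E_j = e_j` and `E_{-1-j} = ± e_j` for `j ≥ 0`, one gets
`T_N(A) E_j = (E_{j+N} + E_{j-N}) / 2`, and the same for `B`. Therefore `T_N(A) - T_N(B)` is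
the Hankel matrix of the antidiagonal `j + k + 1 = N`, and `p_N(A) - p_N(B)` consists of half that
antidiagonal and of the antidiagonals `j + k + 1 = N ± 2`
(`HilbertBasis.inner_aeval_dampedChebyshev`).

*Singular values.* Given `m`, choose `m + 1 ≤ 2ᵖ ≤ 2 (m + 1)` and `n = p + 1`. In the columns
`j = 4i` and rows `k = 4 · 2ⁿ - 1 - 4i'` with `0 ≤ i, i' ≤ m`, the only nonzero entries of
`f(A) - f(B)` lie at `i = i'` and equal `4 ω(2⁻ⁿ) ≥ ω(4 · 2⁻ⁿ) ≥ ω(1 / (1 + m))`. A multiple of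
an identity matrix of size `m + 1` bounds `s_m` from below (`le_singularValue`).
-/

/-! ### Moduli of continuity and dyadic sums -/

section Modulus

variable {ω : ℝ → ℝ}

theorem IsModulusOfContinuity.nonneg (hω : IsModulusOfContinuity ω) {x : ℝ} (hx : 0 ≤ x) :
    0 ≤ ω x := by
  rcases hx.eq_or_lt with rfl | h
  · exact hω.map_zero.ge
  · exact (hω.pos x h).le

theorem IsModulusOfContinuity.map_four_mul_le (hω : IsModulusOfContinuity ω) {x : ℝ}
    (hx : 0 ≤ x) : ω (4 * x) ≤ 4 * ω x := by
  have h1 := hω.subadditive x x hx hx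
  have h2 := hω.subadditive (x + x) (x + x) (by positivity) (by positivity)
  rw [show 4 * x = x + x + (x + x) by ring]
  linarith

/-- The integrand with `ω♯(t) = ∫₀^∞ sharpIntegrand ω t s ds`: it is `ω(s) / s` for `s ≤ t` and
`t ω(s) / s²` for `s > t`. -/
noncomputable def sharpIntegrand (ω : ℝ → ℝ) (t s : ℝ) : ℝ := ω s / s * min 1 (t / s)

theorem sharpIntegrand_of_le {t s : ℝ} (hs : 0 < s) (h : s ≤ t) :
    sharpIntegrand ω t s = ω s / s := by
  rw [sharpIntegrand, min_eq_left ((one_le_div hs).2 h), mul_one]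

theorem sharpIntegrand_of_lt {t s : ℝ} (hs : 0 < s) (h : t < s) :
    sharpIntegrand ω t s = t * (ω s / s ^ 2) := by
  rw [sharpIntegrand, min_eq_right ((div_le_one hs).2 h.le)]
  field_simp

theorem integrableOn_sharpIntegrand (hfin : OmegaSharpFinite ω) {t : ℝ} (ht : 0 < t) :
    IntegrableOn (sharpIntegrand ω t) (Ioc 0 t) ∧ IntegrableOn (sharpIntegrand ω t) (Ioi t) := by
  constructor
  · exact (hfin t ht).2.congr_fun (fun s hs => (sharpIntegrand_of_le hs.1 hs.2).symm)
      measurableSet_Ioc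
  · exact IntegrableOn.congr_fun ((hfin t ht).1.const_mul t)
      (fun s hs => (sharpIntegrand_of_lt (ht.trans hs) hs).symm) measurableSet_Ioi

theorem setIntegral_sharpIntegrand (hfin : OmegaSharpFinite ω) {t : ℝ} (ht : 0 < t) :
    ∫ s in Ioi 0, sharpIntegrand ω t s = omegaSharp ω t := by
  obtain ⟨h1, h2⟩ := integrableOn_sharpIntegrand hfin ht
  rw [← Ioc_union_Ioi_eq_Ioi ht.le, setIntegral_union (by
    rw [Set.disjoint_left]; intro s hs hs'; exact not_lt.2 hs.2 hs') measurableSet_Ioi h1 h2,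
    setIntegral_congr_fun measurableSet_Ioc (fun s hs => sharpIntegrand_of_le hs.1 hs.2),
    setIntegral_congr_fun measurableSet_Ioi
      (fun s hs => sharpIntegrand_of_lt (ht.trans hs) hs), integral_const_mul, omegaSharp, add_comm]

/-- A dyadic block `(a, 2a]` contributes at least a quarter of `ω(a) min(1, t / a)` to `ω♯(t)`. -/
theorem IsModulusOfContinuity.le_intervalIntegral_sharpIntegrand (hω : IsModulusOfContinuity ω)
    {t a : ℝ} (ht : 0 < t) (ha : 0 < a)
    (hint : IntervalIntegrable (sharpIntegrand ω t) volume a (2 * a)) :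
    ω a * min 1 (t / a) / 4 ≤ ∫ s in a..2 * a, sharpIntegrand ω t s := by
  have hm : 0 ≤ min 1 (t / a) := by positivity
  have h := intervalIntegral.integral_mono_on (μ := volume) (a := a) (b := 2 * a)
    (f := fun _ => ω a * min 1 (t / a) / (4 * a)) (g := sharpIntegrand ω t) (by linarith)
    (by simp) hint ?_
  · refine le_trans (le_of_eq ?_) h
    rw [intervalIntegral.integral_const, smul_eq_mul]
    field_simp
    ring
  · rintro s ⟨h1, h2⟩
    have hs : 0 < s := ha.trans_le h1
    have e1 : ω a / (2 * a) ≤ ω s / s := by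
      have := hω.monotoneOn ha.le hs.le h1
      have := hω.nonneg ha.le
      gcongr
      linarith
    have e2 : min 1 (t / a) / 2 ≤ min 1 (t / s) := by
      refine le_min (by linarith [min_le_left 1 (t / a)]) ?_
      calc min 1 (t / a) / 2 ≤ t / a / 2 := by gcongr; exact min_le_right _ _
        _ = t / (2 * a) := by field_simp
        _ ≤ t / s := by gcongr
    calc ω a * min 1 (t / a) / (4 * a) = ω a / (2 * a) * (min 1 (t / a) / 2) := by
          field_simp; ring
      _ ≤ ω s / s * min 1 (t / s) := by
          refine mul_le_mul e1 e2 (by positivity) (div_nonneg (hω.nonneg hs.le) hs.le)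

theorem IsModulusOfContinuity.sum_dyadic_le (hω : IsModulusOfContinuity ω)
    (hfin : OmegaSharpFinite ω) {t : ℝ} (ht : 0 < t) (N : ℕ) :
    ∑ n ∈ Finset.range N, ω ((2 ^ n)⁻¹) * min 1 (2 ^ n * t) ≤ 4 * omegaSharp ω t := by
  have hI : IntegrableOn (sharpIntegrand ω t) (Ioi 0) := by
    obtain ⟨h1, h2⟩ := integrableOn_sharpIntegrand hfin ht
    rw [← Ioc_union_Ioi_eq_Ioi ht.le]
    exact h1.union h2
  have hII : ∀ {a b : ℝ}, 0 < a → 0 < b →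
      IntervalIntegrable (sharpIntegrand ω t) volume a b := by
    intro a b ha hb
    rw [intervalIntegrable_iff]
    exact hI.mono_set fun s hs => (lt_min ha hb).trans hs.1
  have key : ∀ n : ℕ, ω ((2 ^ n)⁻¹) * min 1 (2 ^ n * t) / 4 ≤
      -∫ s in (2 * (2 ^ n)⁻¹)..(2 * (2 ^ (n + 1))⁻¹), sharpIntegrand ω t s := by
    intro n
    have h := hω.le_intervalIntegral_sharpIntegrand ht (a := (2 ^ n)⁻¹) (by positivity)
      (hII (by positivity) (by positivity))
    rw [← intervalIntegral.integral_symm]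
    convert h using 2
    · rw [div_inv_eq_mul, mul_comm t]
    · rw [pow_succ]; field_simp
  have hsum := intervalIntegral.sum_integral_adjacent_intervals (μ := volume)
    (f := sharpIntegrand ω t) (a := fun n : ℕ => 2 * ((2 : ℝ) ^ n)⁻¹) (n := N)
    (fun k _ => hII (by positivity) (by positivity))
  have hle : (2 : ℝ) * (2 ^ N)⁻¹ ≤ 2 * (2 ^ 0)⁻¹ := by
    gcongr
    · norm_num
    · exact Nat.zero_le N
  have htot : ∫ s in (2 * ((2 : ℝ) ^ N)⁻¹)..(2 * (2 ^ 0)⁻¹), sharpIntegrand ω t s ≤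
      omegaSharp ω t := by
    rw [intervalIntegral.integral_of_le hle, ← setIntegral_sharpIntegrand hfin ht]
    refine setIntegral_mono_set hI ?_ (LE.le.eventuallyLE fun s hs => ?_)
    · filter_upwards [ae_restrict_mem measurableSet_Ioi] with s hs
      have hs' : (0 : ℝ) < s := hs
      exact mul_nonneg (div_nonneg (hω.nonneg hs'.le) hs'.le) (by positivity)
    · exact lt_of_le_of_lt (by positivity) hs.1
  have h1 := Finset.sum_le_sum fun n (_ : n ∈ Finset.range N) => key n
  rw [← Finset.sum_div, Finset.sum_neg_distrib, hsum, ← intervalIntegral.integral_symm] at h1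
  linarith

/-- The lacunary sum `∑ ω(2⁻ⁿ) min(1, 2ⁿ t)` is a discretisation of `ω♯(t)`. -/
theorem IsModulusOfContinuity.summable_dyadic (hω : IsModulusOfContinuity ω)
    (hfin : OmegaSharpFinite ω) {t : ℝ} (ht : 0 < t) :
    Summable (fun n : ℕ => ω ((2 ^ n)⁻¹) * min 1 (2 ^ n * t)) ∧
      ∑' n : ℕ, ω ((2 ^ n)⁻¹) * min 1 (2 ^ n * t) ≤ 4 * omegaSharp ω t := by
  have h0 : ∀ n : ℕ, 0 ≤ ω ((2 ^ n)⁻¹) * min 1 (2 ^ n * t) := fun n =>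
    mul_nonneg (hω.nonneg (by positivity)) (by positivity)
  exact ⟨summable_of_sum_range_le h0 (hω.sum_dyadic_le hfin ht),
    Real.tsum_le_of_sum_range_le h0 (hω.sum_dyadic_le hfin ht)⟩

theorem IsModulusOfContinuity.summable_two_pow_inv (hω : IsModulusOfContinuity ω)
    (hfin : OmegaSharpFinite ω) : Summable (fun n : ℕ => ω ((2 ^ n)⁻¹)) := by
  refine (hω.summable_dyadic hfin one_pos).1.congr fun n => ?_
  rw [mul_one, min_eq_left (one_le_pow₀ one_le_two), mul_one]

end Modulus

/-! ### Damped Chebyshev polynomials and the lacunary function -/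

section Chebyshev

open Polynomial

/-- The Chebyshev polynomial `T_N` damped by `1 - X²`; the factor cancels the square root
singularities of `arccos` at `±1`. -/
noncomputable def dampedChebyshev (N : ℕ) : ℝ[X] := (1 - X ^ 2) * Chebyshev.T ℝ N

theorem abs_eval_dampedChebyshev_le (N : ℕ) {x : ℝ} (hx : x ∈ Icc (-1) 1) :
    |(dampedChebyshev N).eval x| ≤ 1 := by
  obtain ⟨θ, -, rfl⟩ : x ∈ Real.cos '' Icc 0 Real.pi := by
    rwa [Real.bijOn_cos.image_eq]
  have h : (dampedChebyshev N).eval (Real.cos θ) = Real.sin θ ^ 2 * Real.cos (N * θ) := by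
    simp [dampedChebyshev, Chebyshev.T_real_cos, Real.sin_sq]
  rw [h, abs_mul, abs_of_nonneg (sq_nonneg _)]
  exact mul_le_one₀ (Real.sin_sq_le_one θ) (abs_nonneg _) (Real.abs_cos_le_one _)

theorem abs_eval_derivative_dampedChebyshev_le (N : ℕ) {x : ℝ} (hx : x ∈ Icc (-1) 1) :
    |(dampedChebyshev N).derivative.eval x| ≤ N + 2 := by
  obtain ⟨θ, -, rfl⟩ : x ∈ Real.cos '' Icc 0 Real.pi := by
    rwa [Real.bijOn_cos.image_eq]
  have hU := Chebyshev.U_real_cos θ ((N : ℤ) - 1)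
  have h : (dampedChebyshev N).derivative.eval (Real.cos θ) =
      N * (Real.sin θ * Real.sin (N * θ)) - 2 * (Real.cos θ * Real.cos (N * θ)) := by
    have e : Real.sin (N * θ) =
        (Chebyshev.U ℝ ((N : ℤ) - 1)).eval (Real.cos θ) * Real.sin θ := by
      rw [hU]; push_cast; ring_nf
    simp [dampedChebyshev, Chebyshev.T_derivative_eq_U, Chebyshev.T_real_cos]
    have := Real.sin_sq θ
    linear_combination (-(N : ℝ) * (Chebyshev.U ℝ ((N : ℤ) - 1)).eval (Real.cos θ)) * this -
      N * Real.sin θ * e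
  have h1 : |Real.sin θ * Real.sin (N * θ)| ≤ 1 := by
    rw [abs_mul]
    exact mul_le_one₀ (Real.abs_sin_le_one _) (abs_nonneg _) (Real.abs_sin_le_one _)
  have h2 : |Real.cos θ * Real.cos (N * θ)| ≤ 1 := by
    rw [abs_mul]
    exact mul_le_one₀ (Real.abs_cos_le_one _) (abs_nonneg _) (Real.abs_cos_le_one _)
  have hN : (0 : ℝ) ≤ N := N.cast_nonneg
  rw [h]
  rw [abs_le] at h1 h2 ⊢
  constructor <;> nlinarith

theorem abs_eval_dampedChebyshev_sub_le (N : ℕ) {x y : ℝ} (hx : x ∈ Icc (-1) 1)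
    (hy : y ∈ Icc (-1) 1) :
    |(dampedChebyshev N).eval x - (dampedChebyshev N).eval y| ≤ (N + 2) * |x - y| :=
  (convex_Icc (-1 : ℝ) 1).norm_image_sub_le_of_norm_hasDerivWithin_le
    (fun z _ => ((dampedChebyshev N).hasDerivAt z).hasDerivWithinAt)
    (fun _ hz => abs_eval_derivative_dampedChebyshev_le N hz) hy hx

/-- The metric projection of `ℝ` onto `[-1, 1]`. -/
noncomputable def clampUnit (x : ℝ) : ℝ := max (-1) (min 1 x)

theorem clampUnit_mem (x : ℝ) : clampUnit x ∈ Icc (-1) 1 :=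
  ⟨le_max_left _ _, max_le (by norm_num) (min_le_left _ _)⟩

theorem clampUnit_of_mem {x : ℝ} (hx : x ∈ Icc (-1) 1) : clampUnit x = x := by
  rw [clampUnit, min_eq_right hx.2, max_eq_right hx.1]

theorem abs_clampUnit_sub_le (x y : ℝ) : |clampUnit x - clampUnit y| ≤ |x - y| :=
  (abs_max_sub_max_le_max (-1) (min 1 x) (-1) (min 1 y)).trans
    (max_le (by simp) ((abs_min_sub_min_le_max 1 x 1 y).trans (by simp)))

/-- The lacunary Chebyshev series `∑ₙ 8 ω(2⁻ⁿ) (1 - x²) T_{4·2ⁿ}(x)` on `[-1, 1]`, extended to `ℝ`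
by constants. -/
noncomputable def lacunaryFun (ω : ℝ → ℝ) (x : ℝ) : ℝ :=
  ∑' n : ℕ, 8 * ω ((2 ^ n)⁻¹) * (dampedChebyshev (4 * 2 ^ n)).eval (clampUnit x)

theorem IsModulusOfContinuity.abs_lacunary_term_le {ω : ℝ → ℝ} (hω : IsModulusOfContinuity ω)
    (n : ℕ) {x : ℝ} (hx : x ∈ Icc (-1) 1) :
    |8 * ω ((2 ^ n)⁻¹) * (dampedChebyshev (4 * 2 ^ n)).eval x| ≤ 8 * ω ((2 ^ n)⁻¹) := by
  have h0 : 0 ≤ 8 * ω ((2 ^ n)⁻¹) := mul_nonneg (by norm_num) (hω.nonneg (by positivity))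
  rw [abs_mul, abs_of_nonneg h0]
  exact mul_le_of_le_one_right h0 (abs_eval_dampedChebyshev_le _ hx)

theorem IsModulusOfContinuity.memLambda_lacunaryFun {ω : ℝ → ℝ} (hω : IsModulusOfContinuity ω)
    (hfin : OmegaSharpFinite ω) : MemLambda (omegaSharp ω) (lacunaryFun ω) := by
  -- `192 = 8 · 6 · 4`: the coefficient in the series, the bound `hp` below, and the dyadic sum.
  refine ⟨192, fun x y hxy => ?_⟩
  have ht : 0 < |x - y| := abs_pos.2 (sub_ne_zero.2 hxy)
  obtain ⟨hs, hle⟩ := hω.summable_dyadic hfin ht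
  have hsum : ∀ z, Summable fun n : ℕ =>
      8 * ω ((2 ^ n)⁻¹) * (dampedChebyshev (4 * 2 ^ n)).eval (clampUnit z) := fun z =>
    Summable.of_norm_bounded ((hω.summable_two_pow_inv hfin).mul_left 8)
      fun n => hω.abs_lacunary_term_le n (clampUnit_mem z)
  rw [lacunaryFun, lacunaryFun, ← (hsum x).tsum_sub (hsum y)]
  have hbound : 48 * ∑' n : ℕ, ω ((2 ^ n)⁻¹) * min 1 (2 ^ n * |x - y|) ≤
      192 * omegaSharp ω |x - y| := by linarith
  rw [← Real.norm_eq_abs]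
  refine (tsum_of_norm_bounded (hs.hasSum.mul_left 48) fun n => ?_).trans hbound
  set P := dampedChebyshev (4 * 2 ^ n)
  have h0 : 0 ≤ ω ((2 ^ n)⁻¹) := hω.nonneg (by positivity)
  have hp : |P.eval (clampUnit x) - P.eval (clampUnit y)| ≤ 6 * min 1 (2 ^ n * |x - y|) := by
    rw [mul_min_of_nonneg _ _ (by norm_num : (0 : ℝ) ≤ 6)]
    refine le_min ?_ ?_
    · have := abs_sub (P.eval (clampUnit x)) (P.eval (clampUnit y))
      have := abs_eval_dampedChebyshev_le (4 * 2 ^ n) (clampUnit_mem x)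
      have := abs_eval_dampedChebyshev_le (4 * 2 ^ n) (clampUnit_mem y)
      linarith
    · refine (abs_eval_dampedChebyshev_sub_le _ (clampUnit_mem x) (clampUnit_mem y)).trans ?_
      have h1 : (1 : ℝ) ≤ 2 ^ n := one_le_pow₀ one_le_two
      calc (((4 * 2 ^ n : ℕ) : ℝ) + 2) * |clampUnit x - clampUnit y|
          ≤ (6 * 2 ^ n) * |x - y| := by
            refine mul_le_mul ?_ (abs_clampUnit_sub_le x y) (abs_nonneg _) (by positivity)
            push_cast
            linarith
        _ = 6 * (2 ^ n * |x - y|) := by ring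
  rw [← mul_sub, Real.norm_eq_abs, abs_mul, abs_of_nonneg (by positivity)]
  nlinarith

theorem IsModulusOfContinuity.tendstoUniformlyOn_lacunaryFun {ω : ℝ → ℝ}
    (hω : IsModulusOfContinuity ω) (hfin : OmegaSharpFinite ω) :
    TendstoUniformlyOn
      (fun N x => (∑ n ∈ Finset.range N,
        C (8 * ω ((2 ^ n)⁻¹)) * dampedChebyshev (4 * 2 ^ n)).eval x)
      (lacunaryFun ω) Filter.atTop (Icc (-1) 1) := by
  refine ((tendstoUniformlyOn_tsum_nat ((hω.summable_two_pow_inv hfin).mul_left 8)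
    fun n x hx => hω.abs_lacunary_term_le n hx).congr
      (.of_forall fun N x hx => ?_)).congr_right fun x hx => ?_
  · simp [eval_finsetSum]
  · rw [lacunaryFun, clampUnit_of_mem hx]

end Chebyshev

/-! ### A lower bound for singular values -/

section Operators

open Polynomial InnerProductSpace

variable {H : Type*} [NormedAddCommGroup H] [InnerProductSpace ℂ H]

/-- If some `(m + 1) × (m + 1)` submatrix of `T` in orthonormal families is `a` times the identity,
then `s_m(T) ≥ a`: an operator of rank at most `m` kills a unit vector `x` in the span of the `u j`,
and `‖T x‖ ≥ a` by Bessel's inequality for the `v i`. -/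
theorem le_singularValue {T : H →L[ℂ] H} {m : ℕ} {a : ℝ} {u v : Fin (m + 1) → H}
    (hu : Orthonormal ℂ u) (hv : Orthonormal ℂ v)
    (hT : ∀ i j, inner ℂ (v i) (T (u j)) = if i = j then (a : ℂ) else 0) :
    a ≤ singularValue T m := by
  refine le_csInf ⟨‖T - 0‖, 0, by simp, rfl⟩ ?_
  rintro _ ⟨R, hR, rfl⟩
  let L : (Fin (m + 1) → ℂ) →ₗ[ℂ] H := Fintype.linearCombination ℂ u
  have hLapp : ∀ c, L c = ∑ i, c i • u i := fun c => Fintype.linearCombination_apply ℂ u c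
  obtain ⟨c, hc, hc0⟩ : ∃ c, R (L c) = 0 ∧ c ≠ 0 := by
    by_contra! hcon
    have hinj : Function.Injective ((R : H →ₗ[ℂ] H) ∘ₗ L) :=
      (injective_iff_map_eq_zero _).2 hcon
    have h1 := LinearMap.rank_comp_le_left L (R : H →ₗ[ℂ] H)
    have h2 := lift_rank_range_of_injective _ hinj
    have h3 := Cardinal.lift_le.{0}.2 (h1.trans hR)
    rw [LinearMap.rank, h2] at h3
    simp only [rank_fin_fun, Cardinal.lift_natCast, Nat.cast_le] at h3
    omega
  have hx : ‖L c‖ ^ 2 = ∑ i, ‖c i‖ ^ 2 := by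
    have := hu.inner_sum c c Finset.univ
    rw [← hLapp, inner_self_eq_norm_sq_to_K] at this
    have h : ((‖L c‖ ^ 2 : ℝ) : ℂ) = ((∑ i, ‖c i‖ ^ 2 : ℝ) : ℂ) := by
      push_cast
      rw [← Complex.coe_algebraMap, this]
      exact Finset.sum_congr rfl fun i _ => by rw [RCLike.conj_mul]
    exact_mod_cast h
  have hcoef : ∀ i, inner ℂ (v i) (T (L c)) = a * c i := by
    intro i
    simp [hLapp, map_sum, hT, mul_comm]
  have hTx : a ^ 2 * ‖L c‖ ^ 2 ≤ ‖T (L c)‖ ^ 2 := by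
    refine le_trans (le_of_eq ?_) (hv.sum_inner_products_le (T (L c)) (s := Finset.univ))
    simp_rw [hcoef, norm_mul, mul_pow, hx, Finset.mul_sum]
    simp
  have hpos : 0 < ‖L c‖ := by
    refine norm_pos_iff.2 fun h0 => hc0 ?_
    rw [h0, norm_zero, zero_pow two_ne_zero, eq_comm,
      Finset.sum_eq_zero_iff_of_nonneg (fun i _ => by positivity)] at hx
    ext i
    simpa using hx i (Finset.mem_univ i)
  have h1 : a * ‖L c‖ ≤ ‖T (L c)‖ := by
    refine le_of_sq_le_sq ?_ (norm_nonneg _)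
    rwa [mul_pow]
  have h2 : ‖T (L c)‖ ≤ ‖T - R‖ * ‖L c‖ := by
    simpa [hc] using (T - R).le_opNorm (L c)
  exact le_of_mul_le_mul_right (h1.trans h2) hpos

/-! ### Chebyshev polynomials of a cosine of a shift -/

/-- If `A` acts on a bilateral sequence `E` like the cosine of a shift, then `T_n(A)` acts like the
cosine of its `n`-th power. -/
theorem aeval_T_apply_of_cosine [CompleteSpace H] {A : H →L[ℂ] H} {E : ℤ → H}
    (hA : ∀ j, A (E j) = (1 / 2 : ℂ) • (E (j + 1) + E (j - 1))) (n : ℕ) (j : ℤ) :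
    aeval A (Chebyshev.T ℝ n) (E j) = (1 / 2 : ℂ) • (E (j + n) + E (j - n)) := by
  induction n using Nat.strong_induction_on generalizing j with
  | _ n ih =>
    match n with
    | 0 => simp [← two_smul ℂ, smul_smul]
    | 1 => simp [hA]
    | n + 2 =>
      have e : Chebyshev.T ℝ ((n + 2 : ℕ) : ℤ) =
          2 * (X * Chebyshev.T ℝ ((n + 1 : ℕ) : ℤ)) - Chebyshev.T ℝ (n : ℤ) := by
        have := Chebyshev.T_add_two ℝ (n : ℤ)
        push_cast
        rw [this, mul_assoc]
      have e' : aeval A (Chebyshev.T ℝ ((n + 2 : ℕ) : ℤ)) (E j) =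
          (2 : ℂ) • A (aeval A (Chebyshev.T ℝ ((n + 1 : ℕ) : ℤ)) (E j)) -
            aeval A (Chebyshev.T ℝ (n : ℤ)) (E j) := by
        rw [e, two_mul, two_smul, map_sub, map_add, map_mul, aeval_X]
        rfl
      rw [e', ih n (by omega), ih (n + 1) (by omega), map_smul, map_add, hA, hA,
        show j + ((n + 1 : ℕ) : ℤ) + 1 = j + ((n + 2 : ℕ) : ℤ) by push_cast; ring,
        show j + ((n + 1 : ℕ) : ℤ) - 1 = j + n by push_cast; ring,
        show j - ((n + 1 : ℕ) : ℤ) + 1 = j - n by push_cast; ring,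
        show j - ((n + 1 : ℕ) : ℤ) - 1 = j - ((n + 2 : ℕ) : ℤ) by push_cast; ring]
      module

theorem aeval_dampedChebyshev_apply_of_cosine [CompleteSpace H] {A : H →L[ℂ] H} {E : ℤ → H}
    (hA : ∀ j, A (E j) = (1 / 2 : ℂ) • (E (j + 1) + E (j - 1))) (N : ℕ) (j : ℤ) :
    aeval A (dampedChebyshev N) (E j) =
      (1 / 4 : ℂ) • (E (j + N) + E (j - N)) -
        (1 / 8 : ℂ) • (E (j + N + 2) + E (j + N - 2) + E (j - N + 2) + E (j - N - 2)) := by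
  have hD : ∀ i, (1 - A ^ 2 : H →L[ℂ] H) (E i) =
      (1 / 2 : ℂ) • E i - (1 / 4 : ℂ) • (E (i + 2) + E (i - 2)) := by
    intro i
    simp only [pow_two, _root_.sub_apply, one_apply_eq_self,
      mul_apply_eq_comp, hA, map_smul, map_add]
    rw [show i + 1 + 1 = i + 2 by ring, show i + 1 - 1 = i by ring, show i - 1 + 1 = i by ring,
      show i - 1 - 1 = i - 2 by ring]
    module
  have hmul : aeval A (dampedChebyshev N) (E j) =
      (1 - A ^ 2 : H →L[ℂ] H) (aeval A (Chebyshev.T ℝ N) (E j)) := by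
    rw [dampedChebyshev, map_mul, map_sub, map_one, map_pow, aeval_X]
    rfl
  rw [hmul, aeval_T_apply_of_cosine hA, map_smul, map_add, hD, hD]
  module

/-! ### Two Jacobi matrices with a rank one difference -/

variable (b : HilbertBasis ℕ ℂ H)

theorem HilbertBasis.inner_eq (m n : ℕ) : inner ℂ (b m) (b n) = if m = n then (1 : ℂ) else 0 :=
  orthonormal_iff_ite.1 b.orthonormal m n

theorem HilbertBasis.ext_inner {x y : H} (h : ∀ n, inner ℂ (b n) x = inner ℂ (b n) y) :
    x = y := by
  refine b.repr.injective (lp.ext (funext fun n => ?_))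
  rw [b.repr_apply_apply, b.repr_apply_apply, h]

/-- The bilateral extension of the basis that is even (odd) under `j ↦ -1 - j` for `ε = 1`
(`ε = -1`). -/
noncomputable def HilbertBasis.reflect (ε : ℝ) (j : ℤ) : H :=
  if 0 ≤ j then b j.toNat else ε • b (-1 - j).toNat

theorem HilbertBasis.reflect_natCast (ε : ℝ) (n : ℕ) : b.reflect ε n = b n := by
  simp [reflect]

theorem HilbertBasis.reflect_neg (ε : ℝ) (n : ℕ) : b.reflect ε (-1 - n) = ε • b n := by
  rw [reflect, if_neg (by omega)]
  simp

theorem HilbertBasis.inner_reflect_sub (k : ℕ) (i : ℤ) :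
    inner ℂ (b k) (b.reflect 1 i - b.reflect (-1) i) =
      if i + k + 1 = 0 then (2 : ℂ) else 0 := by
  rcases le_or_gt 0 i with hi | hi
  · rw [if_neg (by omega), reflect, reflect, if_pos hi, if_pos hi, sub_self, inner_zero_right]
  · rw [reflect, reflect, if_neg (by omega), if_neg (by omega), one_smul, neg_one_smul,
      sub_neg_eq_add, inner_add_right, inner_eq]
    by_cases h : i + k + 1 = 0
    · rw [if_pos h, if_pos (by omega)]; norm_num
    · rw [if_neg h, if_neg (by omega)]; norm_num

variable [CompleteSpace H]

/-- The unilateral shift `b n ↦ b (n + 1)`. -/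
noncomputable def HilbertBasis.shift : H →ₗᵢ[ℂ] H :=
  (b.orthonormal.comp _ Nat.succ_injective).orthogonalFamily.linearIsometry.comp
    b.repr.toLinearIsometry

theorem HilbertBasis.shift_apply_basis (n : ℕ) : b.shift (b n) = b (n + 1) := by
  simp [HilbertBasis.shift, HilbertBasis.repr_self, OrthogonalFamily.linearIsometry_apply_single]

theorem HilbertBasis.adjoint_shift_apply_succ (n : ℕ) :
    ContinuousLinearMap.adjoint b.shift.toContinuousLinearMap (b (n + 1)) = b n := by
  refine b.ext_inner fun m => ?_
  rw [ContinuousLinearMap.adjoint_inner_right]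
  simp [shift_apply_basis, inner_eq]

theorem HilbertBasis.adjoint_shift_apply_zero :
    ContinuousLinearMap.adjoint b.shift.toContinuousLinearMap (b 0) = 0 := by
  refine b.ext_inner fun m => ?_
  rw [ContinuousLinearMap.adjoint_inner_right]
  simp [shift_apply_basis, inner_eq]

theorem HilbertBasis.inner_zero_shift (x : H) : inner ℂ (b 0) (b.shift x) = 0 := by
  have := ContinuousLinearMap.adjoint_inner_left b.shift.toContinuousLinearMap x (b 0)
  rw [adjoint_shift_apply_zero, inner_zero_left] at this
  exact this.symm

/-- The Jacobi matrix with off-diagonal entries `1/2` and diagonal `(ε/2, 0, 0, …)`. For `ε = ±1` it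
is the compression of the bilateral `(U + U*)/2` to the even (odd) sequences with respect to the
reflection `j ↦ -1 - j`. -/
noncomputable def HilbertBasis.jacobi (ε : ℝ) : H →L[ℂ] H :=
  (1 / 2 : ℝ) • (b.shift.toContinuousLinearMap +
    ContinuousLinearMap.adjoint b.shift.toContinuousLinearMap + ε • rankOne ℂ (b 0) (b 0))

theorem HilbertBasis.isSelfAdjoint_jacobi (ε : ℝ) : IsSelfAdjoint (b.jacobi ε) := by
  refine IsSelfAdjoint.smul (IsSelfAdjoint.all _) (IsSelfAdjoint.add ?_ (IsSelfAdjoint.smul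
    (IsSelfAdjoint.all _) ?_))
  · exact IsSelfAdjoint.add_star_self _
  · rw [ContinuousLinearMap.isSelfAdjoint_iff', adjoint_rankOne]

theorem HilbertBasis.jacobi_apply (ε : ℝ) (x : H) :
    b.jacobi ε x = (1 / 2 : ℝ) • (b.shift x +
      ContinuousLinearMap.adjoint b.shift.toContinuousLinearMap x +
        ε • inner ℂ (b 0) x • b 0) := by
  simp [jacobi]

theorem HilbertBasis.jacobi_apply_reflect {ε : ℝ} (hε : ε * ε = 1) (j : ℤ) :
    b.jacobi ε (b.reflect ε j) =
      (1 / 2 : ℂ) • (b.reflect ε (j + 1) + b.reflect ε (j - 1)) := by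
  have h2 : ∀ x : H, (1 / 2 : ℂ) • x = (1 / 2 : ℝ) • x := fun x => by
    rw [← Complex.coe_smul]; norm_num
  have key0 : b.jacobi ε (b 0) = (1 / 2 : ℝ) • (b 1 + ε • b 0) := by
    rw [jacobi_apply, shift_apply_basis, adjoint_shift_apply_zero, inner_eq]
    simp
  have keyS : ∀ n, b.jacobi ε (b (n + 1)) = (1 / 2 : ℝ) • (b (n + 2) + b n) := by
    intro n
    rw [jacobi_apply, shift_apply_basis, adjoint_shift_apply_succ, inner_eq]
    simp
  have r1 : b.reflect ε (-1) = ε • b 0 := by simpa using b.reflect_neg ε 0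
  rw [h2]
  rcases le_or_gt 0 j with hj | hj
  · lift j to ℕ using hj
    rw [reflect_natCast]
    rcases j with _ | n
    · rw [key0, show ((0 : ℕ) : ℤ) + 1 = ((1 : ℕ) : ℤ) by simp, reflect_natCast,
        show ((0 : ℕ) : ℤ) - 1 = -1 by simp, r1]
    · rw [keyS, show ((n + 1 : ℕ) : ℤ) + 1 = ((n + 2 : ℕ) : ℤ) by push_cast; ring,
        show ((n + 1 : ℕ) : ℤ) - 1 = (n : ℤ) by push_cast; ring, reflect_natCast, reflect_natCast]
  · obtain ⟨n, rfl⟩ : ∃ n : ℕ, j = -1 - n := ⟨(-1 - j).toNat, by omega⟩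
    have hsm : ∀ x, b.jacobi ε (ε • x) = ε • b.jacobi ε x := fun x => by
      rw [← Complex.coe_smul, map_smul, Complex.coe_smul]
    rw [reflect_neg, hsm]
    have hm : (-1 - (n : ℤ)) - 1 = -1 - ((n + 1 : ℕ) : ℤ) := by push_cast; ring
    rw [hm, reflect_neg]
    rcases n with _ | n
    · rw [key0, show (-1 - ((0 : ℕ) : ℤ)) + 1 = ((0 : ℕ) : ℤ) by simp, reflect_natCast,
        smul_comm, smul_add, smul_smul, hε, one_smul, add_comm]
    · rw [keyS, show (-1 - ((n + 1 : ℕ) : ℤ)) + 1 = -1 - (n : ℤ) by push_cast; ring, reflect_neg,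
        smul_comm, smul_add, add_comm]

theorem HilbertBasis.norm_jacobi_le {ε : ℝ} (hε : |ε| = 1) : ‖b.jacobi ε‖ ≤ 1 := by
  refine ContinuousLinearMap.opNorm_le_bound _ zero_le_one fun x => ?_
  set S := b.shift.toContinuousLinearMap
  set c : ℂ := inner ℂ (b 0) x
  set y := b.shift x + ε • c • b 0
  set z := ContinuousLinearMap.adjoint S x
  have hb0 : ‖b 0‖ = 1 := b.orthonormal.1 0
  have hy : ‖y‖ ^ 2 = ‖x‖ ^ 2 + ‖c‖ ^ 2 := by
    have horth : inner ℂ (b.shift x) (ε • c • b 0) = 0 := by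
      rw [← Complex.coe_smul, inner_smul_right, inner_smul_right, ← inner_conj_symm,
        inner_zero_shift]
      simp
    have := norm_add_sq_eq_norm_sq_add_norm_sq_of_inner_eq_zero _ _ horth
    simp only [norm_smul, hb0, Real.norm_eq_abs, hε, b.shift.norm_map] at this
    simp only [y]
    nlinarith
  -- `S z = S S* x` and `c • b 0` are orthogonal components of `x`.
  have hz : ‖z‖ ^ 2 + ‖c‖ ^ 2 ≤ ‖x‖ ^ 2 := by
    have h1 : inner ℂ (S z) (x - S z - c • b 0) = 0 := by
      have e1 : inner ℂ (S z) x = inner ℂ z z :=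
        (ContinuousLinearMap.adjoint_inner_right S z x).symm
      have e2 : inner ℂ (S z) (S z) = inner ℂ z z := b.shift.inner_map_map z z
      have e3 : inner ℂ (S z) (b 0) = 0 := by
        rw [← inner_conj_symm]
        simp [S, inner_zero_shift]
      rw [inner_sub_right, inner_sub_right, inner_smul_right, e1, e2, e3]
      simp
    have h2 : inner ℂ (c • b 0) (x - c • b 0) = 0 := by
      rw [inner_smul_left, inner_sub_right, inner_smul_right, inner_eq]
      simp [c]
    have h3 := norm_add_sq_eq_norm_sq_add_norm_sq_of_inner_eq_zero _ _ h1
    have h4 := norm_add_sq_eq_norm_sq_add_norm_sq_of_inner_eq_zero _ _ h2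
    have h5 : ‖S z‖ = ‖z‖ := b.shift.norm_map z
    rw [show S z + (x - S z - c • b 0) = x - c • b 0 by abel, h5] at h3
    rw [add_sub_cancel, norm_smul, hb0, mul_one] at h4
    nlinarith [norm_nonneg (x - S z - c • b 0)]
  have hpar := parallelogram_law_with_norm ℂ y z
  have hJ : b.jacobi ε x = (1 / 2 : ℝ) • (y + z) := by
    rw [jacobi_apply]
    congr 1
    simp only [y, z, S, c]
    abel
  have hfin : ‖y + z‖ ^ 2 ≤ (2 * ‖x‖) ^ 2 := by
    nlinarith [norm_nonneg (y - z)]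
  have := le_of_sq_le_sq hfin (by positivity)
  rw [hJ, norm_smul]
  norm_num
  linarith

theorem HilbertBasis.jacobi_one_sub : b.jacobi 1 - b.jacobi (-1) = rankOne ℂ (b 0) (b 0) := by
  ext x
  rw [_root_.sub_apply, jacobi_apply, jacobi_apply, rankOne_apply]
  module

theorem HilbertBasis.spectrum_jacobi_subset {ε : ℝ} (hε : |ε| = 1) :
    spectrum ℝ (b.jacobi ε) ⊆ Icc (-1) 1 := by
  intro k hk
  have h1 : ‖(1 : H →L[ℂ] H)‖ ≤ 1 := ContinuousLinearMap.norm_id_le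
  have h := spectrum.norm_le_norm_mul_of_mem hk
  have h2 := mul_le_one₀ (b.norm_jacobi_le hε) (norm_nonneg _) h1
  exact abs_le.1 (h.trans h2)

/-- The matrix of `T_N(A) - T_N(B)` is the antidiagonal `j + k + 1 = N`; damping by `1 - X²` halves
it and adds the antidiagonals `j + k + 1 = N ± 2`, which a congruence mod `4` avoids. -/
theorem HilbertBasis.inner_aeval_dampedChebyshev {N j k : ℕ} (hN : 4 ∣ N) (hjk : 4 ∣ j + k + 1) :
    inner ℂ (b k) ((aeval (b.jacobi 1) (dampedChebyshev N) -
      aeval (b.jacobi (-1)) (dampedChebyshev N)) (b j)) =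
        if j + k + 1 = N then (1 / 2 : ℂ) else 0 := by
  rw [_root_.sub_apply]
  rw [show b j = b.reflect 1 j from (b.reflect_natCast 1 j).symm]
  nth_rw 2 [show b.reflect 1 j = b.reflect (-1) j by rw [reflect_natCast, reflect_natCast]]
  rw [aeval_dampedChebyshev_apply_of_cosine (b.jacobi_apply_reflect (by norm_num)),
    aeval_dampedChebyshev_apply_of_cosine (b.jacobi_apply_reflect (by norm_num))]
  set D : ℤ → H := fun i => b.reflect 1 i - b.reflect (-1) i
  have hD : ∀ i, inner ℂ (b k) (D i) = if i + k + 1 = 0 then (2 : ℂ) else 0 :=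
    b.inner_reflect_sub k
  have e : ∀ F G : ℤ → H, ∀ i₁ i₂ i₃ i₄ i₅ i₆ : ℤ,
      (1 / 4 : ℂ) • (F i₁ + F i₂) - (1 / 8 : ℂ) • (F i₃ + F i₄ + F i₅ + F i₆) -
        ((1 / 4 : ℂ) • (G i₁ + G i₂) - (1 / 8 : ℂ) • (G i₃ + G i₄ + G i₅ + G i₆)) =
      (1 / 4 : ℂ) • ((F i₁ - G i₁) + (F i₂ - G i₂)) - (1 / 8 : ℂ) •
        ((F i₃ - G i₃) + (F i₄ - G i₄) + (F i₅ - G i₅) + (F i₆ - G i₆)) := by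
    intros; module
  rw [e]
  change inner ℂ (b k) ((1 / 4 : ℂ) • (D _ + D _) -
    (1 / 8 : ℂ) • (D _ + D _ + D _ + D _)) = _
  simp only [inner_sub_right, inner_smul_right, inner_add_right, hD]
  rw [if_neg (show ¬ ((j : ℤ) + N + k + 1 = 0) by omega),
    if_neg (show ¬ ((j : ℤ) + N + 2 + k + 1 = 0) by omega),
    if_neg (show ¬ ((j : ℤ) + N - 2 + k + 1 = 0) by omega),
    if_neg (show ¬ ((j : ℤ) - N + 2 + k + 1 = 0) by omega),
    if_neg (show ¬ ((j : ℤ) - N - 2 + k + 1 = 0) by omega)]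
  by_cases h : j + k + 1 = N
  · rw [if_pos h, if_pos (by omega)]; norm_num
  · rw [if_neg h, if_neg (by omega)]; norm_num

/-! ### The matrix of the difference of the functional calculi -/

theorem HilbertBasis.tendsto_aeval_lacunary {ω : ℝ → ℝ} (hω : IsModulusOfContinuity ω)
    (hfin : OmegaSharpFinite ω) {ε : ℝ} (hε : |ε| = 1) :
    Filter.Tendsto (fun M => ∑ n ∈ Finset.range M,
      (8 * ω ((2 ^ n)⁻¹)) • aeval (b.jacobi ε) (dampedChebyshev (4 * 2 ^ n)))
      Filter.atTop (nhds (cfc (lacunaryFun ω) (b.jacobi ε))) := by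
  have h := tendsto_cfc_fun (a := b.jacobi ε)
    ((hω.tendstoUniformlyOn_lacunaryFun hfin).mono (b.spectrum_jacobi_subset hε))
    (.of_forall fun M => (Polynomial.continuous _).continuousOn)
  refine h.congr fun M => ?_
  rw [cfc_polynomial _ _ (b.isSelfAdjoint_jacobi ε), map_sum]
  refine Finset.sum_congr rfl fun n _ => ?_
  rw [map_mul, aeval_C, Algebra.smul_def]

/-- Along rows and columns with `4 ∣ j + k + 1`, the matrix of `f(A) - f(B)` is supported on the
antidiagonals `j + k + 1 = 4 · 2ⁿ`. The hypothesis `h` says that at most `n = p` contributes. -/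
theorem HilbertBasis.inner_cfc_lacunary {ω : ℝ → ℝ} (hω : IsModulusOfContinuity ω)
    (hfin : OmegaSharpFinite ω) {p j k : ℕ} (hjk : 4 ∣ j + k + 1)
    (h : ∀ n, j + k + 1 = 4 * 2 ^ n → n = p) :
    inner ℂ (b k) ((cfc (lacunaryFun ω) (b.jacobi 1) - cfc (lacunaryFun ω) (b.jacobi (-1))) (b j)) =
      if j + k + 1 = 4 * 2 ^ p then ((4 * ω ((2 ^ p)⁻¹) : ℝ) : ℂ) else 0 := by
  have ht := (b.tendsto_aeval_lacunary hω hfin (ε := 1) (by simp)).sub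
    (b.tendsto_aeval_lacunary hω hfin (ε := -1) (by simp))
  have hc : Continuous fun T : H →L[ℂ] H => inner ℂ (b k) (T (b j)) := by fun_prop
  refine tendsto_nhds_unique ((hc.tendsto _).comp ht) ?_
  refine tendsto_const_nhds.congr' ?_
  filter_upwards [Filter.eventually_gt_atTop p] with M hM
  simp only [Function.comp_apply, ← Finset.sum_sub_distrib, ← smul_sub,
    _root_.sum_apply, _root_.smul_apply, inner_sum]
  rw [Finset.sum_eq_single_of_mem p (Finset.mem_range.2 hM)]
  · rw [← Complex.coe_smul, inner_smul_right, b.inner_aeval_dampedChebyshev ⟨_, rfl⟩ hjk]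
    split_ifs
    · push_cast; ring
    · simp
  · intro n _ hn
    rw [← Complex.coe_smul, inner_smul_right, b.inner_aeval_dampedChebyshev ⟨_, rfl⟩ hjk,
      if_neg fun h' => hn (h n h'), mul_zero]

theorem HilbertBasis.le_singularValue_cfc_lacunary {ω : ℝ → ℝ} (hω : IsModulusOfContinuity ω)
    (hfin : OmegaSharpFinite ω) (m : ℕ) :
    ω ((1 + (m : ℝ))⁻¹) ≤ singularValue
      (cfc (lacunaryFun ω) (b.jacobi 1) - cfc (lacunaryFun ω) (b.jacobi (-1))) m := by
  obtain ⟨p, hp1, hp2⟩ : ∃ p : ℕ, m + 1 ≤ 2 ^ p ∧ 2 ^ p ≤ 2 * (m + 1) :=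
    ⟨Nat.log 2 (m + 1) + 1, (Nat.lt_pow_succ_log_self one_lt_two _).le, by
      rw [pow_succ, mul_comm]
      exact Nat.mul_le_mul_left _ (Nat.pow_log_le_self 2 (by omega))⟩
  have hmod : ω ((1 + (m : ℝ))⁻¹) ≤ 4 * ω ((2 ^ (p + 1))⁻¹) := by
    refine le_trans (hω.monotoneOn (by simp; positivity) (by simp) ?_)
      (hω.map_four_mul_le (by positivity))
    have h : (2 : ℝ) ^ p ≤ 2 * (m + 1) := by exact_mod_cast hp2
    rw [pow_succ, ← div_eq_mul_inv, inv_eq_one_div, div_le_div_iff₀ (by positivity) (by positivity)]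
    linarith
  refine hmod.trans ?_
  have hpow : 2 ^ (p + 1) = 2 * 2 ^ p := by rw [pow_succ, mul_comm]
  refine le_singularValue (u := fun i : Fin (m + 1) => b (4 * i))
    (v := fun i : Fin (m + 1) => b (4 * 2 ^ (p + 1) - 1 - 4 * i))
    (b.orthonormal.comp (fun i : Fin (m + 1) => 4 * (i : ℕ)) fun i j h => by
      simp only at h; omega)
    (b.orthonormal.comp (fun i : Fin (m + 1) => 4 * 2 ^ (p + 1) - 1 - 4 * (i : ℕ))
      fun i j h => by simp only at h; omega) fun i j => ?_
  have hi := i.2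
  have hj := j.2
  have hsum : 4 * (j : ℕ) + (4 * 2 ^ (p + 1) - 1 - 4 * i) + 1 = 4 * (2 ^ (p + 1) + j - i) := by
    omega
  rw [b.inner_cfc_lacunary hω hfin (p := p + 1) ⟨_, hsum⟩]
  · rw [hsum]
    congr 1
    rw [Fin.ext_iff, eq_iff_iff]
    omega
  · -- `|i - j| < 2 ^ p`, so that `2 ^ n` lies strictly between `2 ^ p` and `2 ^ (p + 2)`.
    intro n hn
    have h1 : 2 ^ p < 2 ^ n := by omega
    have h2 : 2 ^ n < 2 ^ (p + 2) := by rw [pow_succ, pow_succ]; omega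
    rw [Nat.pow_lt_pow_iff_right one_lt_two] at h1 h2
    omega

end Operators

theorem mainTheorem4 (ω : ℝ → ℝ) (hω : IsModulusOfContinuity ω) (hfin : OmegaSharpFinite ω) :
    ∃ (H : Type) (_ : NormedAddCommGroup H) (_ : InnerProductSpace ℂ H) (_ : CompleteSpace H)
      (A B : H →L[ℂ] H) (f : ℝ → ℝ),
      IsSelfAdjoint A ∧ IsSelfAdjoint B ∧
      MemLambda (omegaSharp ω) f ∧
      LinearMap.rank ((A - B : H →L[ℂ] H) : H →ₗ[ℂ] H) = 1 ∧
      ∀ m : ℕ, ω ((1 + (m : ℝ))⁻¹) ≤ singularValue (cfc f A - cfc f B) m := by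
  let b : HilbertBasis ℕ ℂ (lp (fun _ : ℕ => ℂ) 2) := HilbertBasis.ofRepr (.refl ℂ _)
  have hb : b 0 ≠ 0 := b.orthonormal.ne_zero 0
  refine ⟨lp (fun _ : ℕ => ℂ) 2, inferInstance, inferInstance, inferInstance, b.jacobi 1,
    b.jacobi (-1), lacunaryFun ω, b.isSelfAdjoint_jacobi 1, b.isSelfAdjoint_jacobi (-1),
    hω.memLambda_lacunaryFun hfin, ?_, b.le_singularValue_cfc_lacunary hω hfin⟩
  rw [b.jacobi_one_sub]
  exact InnerProductSpace.rank_rankOne hb hb
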